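/- Let $R$ be an associative, not necessarily commutative ring with identity, let $\mathcal X$ be any class of right $R$-modules, let $n\ge 0$ be an integer and let $M$ be a left $R$-module. A left $R$-module $N$ is called $\mathcal X$-Mittag-Leffler if for each family $\{F_i : i\in I\}$ of modules in $\mathcal X$ the canonical map $\left(\prod_{i\in I}F_i\right)\otimes_R N\to\prod_{i\in I}\left(F_i\otimes_R N\right)$ is injective. Let $\mathcal M^{\mathcal X}$ be the class of all $\mathcal X$-Mittag-Leffler left $R$-modules. A left $R$-module has $\mathcal M^{\mathcal X}$-projective dimension (also called $\mathcal M^{\mathcal X}$-Mittag-Leffler dimension) at most $n$ if it has a projective resolution whose $(n-1)$-st syzygy belongs to $\mathcal M^{\mathcal X}$; here the $(-1)$-st syzygy is the module itself, and the $0$-th syzygy is the kernel of the augmentation. Let $\mathcal M^{\mathcal X}_n$ be the class of all left $R$-modules of $\mathcal M^{\mathcal X}$-projective dimension at most $n$. For a class $\mathcal Y$ of left $R$-modules, $M$ is called $(\aleph_1,\mathcal Y)$-free if there is a set $\mathcal S$ of submodules of $M$, all belonging to $\mathcal Y$ and directed under inclusion, such that (i) $\mathcal S$ is closed under unions of nonempty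 well-ordered ascending chains of length smaller than $\aleph_1$, and (ii) every subset of $M$ of cardinality smaller than $\aleph_1$ is contained in an element of $\mathcal S$. Then the following assertions are equivalent: 1. $M$ has $\mathcal M^{\mathcal X}$-projective dimension at most $n$. 2. $M$ is $(\aleph_1,\mathcal M^{\mathcal X}_n)$-free. -/

import Mathlib

open scoped TensorProduct Cardinal

universe u

namespace RelativeML

section Tensor

variable {R : Type u} [Ring R]

/-- The subgroup of `A ⊗[ℤ] M` generated by the elements `(a r) ⊗ m - a ⊗ (r m)`, for a right
`R`-module `A` (a left module over `Rᵐᵒᵖ`) and a left `R`-module `M`. -/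
def balancedRel (R : Type u) [Ring R] (A : Type u) [AddCommGroup A] [Module Rᵐᵒᵖ A]
    (M : Type u) [AddCommGroup M] [Module R M] : AddSubgroup (A ⊗[ℤ] M) :=
  AddSubgroup.closure
    {t | ∃ (a : A) (r : R) (m : M), t = (MulOpposite.op r • a) ⊗ₜ[ℤ] m - a ⊗ₜ[ℤ] (r • m)}

/-- The tensor product over `R` (not necessarily commutative) of a right `R`-module `A` and a left
`R`-module `M`. -/
abbrev Tensor (R : Type u) [Ring R] (A : Type u) [AddCommGroup A] [Module Rᵐᵒᵖ A]
    (M : Type u) [AddCommGroup M] [Module R M] : Type u :=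
  (A ⊗[ℤ] M) ⧸ balancedRel R A M

variable {A B : Type u} [AddCommGroup A] [Module Rᵐᵒᵖ A] [AddCommGroup B] [Module Rᵐᵒᵖ B]

theorem balancedRel_le_comap (f : A →ₗ[Rᵐᵒᵖ] B) (M : Type u) [AddCommGroup M] [Module R M] :
    balancedRel R A M ≤
      (balancedRel R B M).comap
        (TensorProduct.map f.toAddMonoidHom.toIntLinearMap
          (LinearMap.id : M →ₗ[ℤ] M)).toAddMonoidHom := by
  refine (AddSubgroup.closure_le _).2 ?_
  rintro _ ⟨a, r, m, rfl⟩
  refine AddSubgroup.subset_closure ⟨f a, r, m, ?_⟩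
  simp

/-- The homomorphism `A ⊗_R M → B ⊗_R M`, `a ⊗ m ↦ f a ⊗ m`. -/
def tensorMap (f : A →ₗ[Rᵐᵒᵖ] B) (M : Type u) [AddCommGroup M] [Module R M] :
    Tensor R A M →+ Tensor R B M :=
  QuotientAddGroup.map (balancedRel R A M) (balancedRel R B M)
    (TensorProduct.map f.toAddMonoidHom.toIntLinearMap
      (LinearMap.id : M →ₗ[ℤ] M)).toAddMonoidHom
    (balancedRel_le_comap f M)

/-- The canonical homomorphism `(∏ i, F i) ⊗_R M → ∏ i, (F i ⊗_R M)`. -/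
def prodTensorMap {I : Type u} (F : I → ModuleCat.{u} Rᵐᵒᵖ)
    (M : Type u) [AddCommGroup M] [Module R M] :
    Tensor R (∀ i, F i) M →+ ∀ i, Tensor R (F i) M :=
  AddMonoidHom.pi fun i => tensorMap (LinearMap.proj i) M

end Tensor

section Classes

variable {R : Type u} [Ring R]

/-- `MittagLeffler X` is the class of all `X`-Mittag-Leffler left `R`-modules, for a class `X` of
right `R`-modules. -/
def MittagLeffler (X : ModuleCat.{u} Rᵐᵒᵖ → Prop) (M : ModuleCat.{u} R) : Prop :=
  ∀ (I : Type u) (F : I → ModuleCat.{u} Rᵐᵒᵖ), (∀ i, X (F i)) →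
    Function.Injective (prodTensorMap F M)

/-- A projective resolution `⋯ → P 2 → P 1 → P 0 → M → 0`. -/
structure ProjRes (M : ModuleCat.{u} R) where
  P : ℕ → ModuleCat.{u} R
  d : ∀ i, P (i + 1) →ₗ[R] P i
  aug : P 0 →ₗ[R] M
  projective : ∀ i, Module.Projective R (P i)
  aug_surjective : Function.Surjective aug
  exact_zero : Function.Exact (d 0) aug
  exact_succ : ∀ i, Function.Exact (d (i + 1)) (d i)

/-- `Q.syzygy n` is the `(n-1)`-st syzygy of the resolution `Q`: the module `M` for `n = 0`, the
kernel of `P 0 → M` for `n = 1`, and the kernel of `P (n-1) → P (n-2)` for `n ≥ 2`. -/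
def ProjRes.syzygy {M : ModuleCat.{u} R} (Q : ProjRes M) : ℕ → ModuleCat.{u} R
  | 0 => M
  | 1 => ModuleCat.of R (LinearMap.ker Q.aug)
  | k + 2 => ModuleCat.of R (LinearMap.ker (Q.d k))

/-- `RelProjDimLE Y n` is the class `Y_n` of all modules of `Y`-projective dimension at most `n`:
some projective resolution of the module has its `(n-1)`-st syzygy in `Y`. -/
def RelProjDimLE (Y : ModuleCat.{u} R → Prop) (n : ℕ) (M : ModuleCat.{u} R) : Prop :=
  ∃ Q : ProjRes M, Y (Q.syzygy n)

/-- `S` is a `(κ, Y)`-dense system of submodules of `M`. -/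
structure IsDenseSystem (κ : Cardinal.{u}) (Y : ModuleCat.{u} R → Prop) (M : ModuleCat.{u} R)
    (S : Set (Submodule R M)) : Prop where
  mem_class : ∀ N ∈ S, Y (ModuleCat.of R N)
  directed : DirectedOn (· ≤ ·) S
  /-- Closure under unions of nonempty well-ordered ascending chains of length `μ < κ`
  (for a nonempty chain the supremum is the union). -/
  iSup_mem : ∀ μ : Ordinal.{u}, 0 < μ → μ < κ.ord → ∀ f : Set.Iio μ → Submodule R M,
    Monotone f → (∀ α, f α ∈ S) → (⨆ α, f α) ∈ S
  exists_ge : ∀ T : Set M, #T < κ → ∃ N ∈ S, T ⊆ N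

/-- `M` is `(κ, Y)`-free, for an infinite regular cardinal `κ`. -/
def IsFree (κ : Cardinal.{u}) (Y : ModuleCat.{u} R → Prop) (M : ModuleCat.{u} R) : Prop :=
  ∃ S : Set (Submodule R M), IsDenseSystem κ Y M S

end Classes

end RelativeML

/-! If `M` has dimension at most `n`, the system `{⊤}` witnesses freeness. The converse goes by
induction on `n`.

For `n = 0`, take `t` in `(∏ F i) ⊗ M` with all components zero. It comes from some `N₀` in the
dense system `S`. It is enough to find a larger member of `S` in which every component of `t`
already vanishes, since that member is Mittag-Leffler. If there were none, each member would have a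
surviving component that dies in some larger member. Iterating gives a countable chain whose union
`P` lies in `S`. Restrict `t` to the indices whose components vanish over `P`: the Mittag-Leffler
property of `P` kills this restriction over `P`, hence over one term of the chain. But the component
chosen at that term survives there and dies in `P`, a contradiction
(`exists_forall_tensorMap_eq_zero`).

For `n + 1`, `isFree_coverKernel` moves the dense system to the kernel of a free cover of `M`,
replacing `N` by the relations supported on `N`. By Schanuel's lemma these kernels have dimension at
most `n`, so the induction hypothesis applies to the kernel over `M`. -/

namespace RelativeML

/-! ### Tensor products over a noncommutative ring and directed unions -/

section TensorBasics

variable {R : Type u} [Ring R]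
variable {A B : Type u} [AddCommGroup A] [Module Rᵐᵒᵖ A] [AddCommGroup B] [Module Rᵐᵒᵖ B]
variable {M N L : Type u} [AddCommGroup M] [Module R M] [AddCommGroup N] [Module R N]
  [AddCommGroup L] [Module R L]

/-- The pure tensor `a ⊗ m`. -/
def tmul (R : Type u) [Ring R] {A : Type u} [AddCommGroup A] [Module Rᵐᵒᵖ A]
    {M : Type u} [AddCommGroup M] [Module R M] (a : A) (m : M) : Tensor R A M :=
  QuotientAddGroup.mk (a ⊗ₜ[ℤ] m)

theorem tmul_add (a : A) (m m' : M) : tmul R a (m + m') = tmul R a m + tmul R a m' := by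
  simp only [tmul, TensorProduct.tmul_add, QuotientAddGroup.mk_add]

theorem add_tmul (a a' : A) (m : M) : tmul R (a + a') m = tmul R a m + tmul R a' m := by
  simp only [tmul, TensorProduct.add_tmul, QuotientAddGroup.mk_add]

theorem smul_tmul (a : A) (r : R) (m : M) :
    tmul R (MulOpposite.op r • a) m = tmul R a (r • m) := by
  refine (QuotientAddGroup.eq_iff_sub_mem).2 (AddSubgroup.subset_closure ⟨a, r, m, rfl⟩)

theorem tensor_induction {p : Tensor R A M → Prop} (t : Tensor R A M) (zero : p 0)
    (tmul : ∀ a m, p (tmul R a m)) (add : ∀ x y, p x → p y → p (x + y)) : p t := by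
  obtain ⟨t, rfl⟩ := QuotientAddGroup.mk_surjective t
  induction t using TensorProduct.induction_on with
  | zero => exact zero
  | tmul a m => exact tmul a m
  | add x y hx hy => exact add _ _ hx hy

theorem tensor_hom_ext {G : Type*} [AddCommGroup G] {f g : Tensor R A M →+ G}
    (h : ∀ a m, f (tmul R a m) = g (tmul R a m)) : f = g := by
  refine DFunLike.ext _ _ fun t => ?_
  induction t using tensor_induction with
  | zero => simp only [map_zero]
  | tmul a m => exact h a m
  | add x y hx hy => simp only [map_add, hx, hy]

/-- The homomorphism out of the tensor product given by a balanced biadditive map. -/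
def tensorLift {G : Type*} [AddCommGroup G] (f : A →+ M →+ G)
    (hf : ∀ a (r : R) m, f (MulOpposite.op r • a) m = f a (r • m)) : Tensor R A M →+ G :=
  QuotientAddGroup.lift (balancedRel R A M)
    (TensorProduct.liftAddHom f fun r a m => by simp) <| by
      refine (AddSubgroup.closure_le _).2 ?_
      rintro _ ⟨a, r, m, rfl⟩
      simp [AddMonoidHom.mem_ker, hf]

@[simp]
theorem tensorLift_tmul {G : Type*} [AddCommGroup G] (f : A →+ M →+ G)
    (hf : ∀ a (r : R) m, f (MulOpposite.op r • a) m = f a (r • m)) (a : A) (m : M) :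
    tensorLift f hf (tmul R a m) = f a m := by
  rfl

@[simp]
theorem tensorMap_tmul (f : A →ₗ[Rᵐᵒᵖ] B) (a : A) (m : M) :
    tensorMap f M (tmul R a m) = tmul R (f a) m := by
  simp [tensorMap, tmul]

/-- The homomorphism `A ⊗_R M → A ⊗_R N`, `a ⊗ m ↦ a ⊗ g m`. -/
def tensorMapRight (A : Type u) [AddCommGroup A] [Module Rᵐᵒᵖ A] (g : M →ₗ[R] N) :
    Tensor R A M →+ Tensor R A N :=
  tensorLift
    (AddMonoidHom.mk' (fun a => AddMonoidHom.mk' (fun m => tmul R a (g m))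
      fun m m' => by rw [map_add, tmul_add])
      fun a a' => by ext m; exact add_tmul _ _ _)
    fun a r m => by simp [smul_tmul]

@[simp]
theorem tensorMapRight_tmul (g : M →ₗ[R] N) (a : A) (m : M) :
    tensorMapRight A g (tmul R a m) = tmul R a (g m) := by
  simp [tensorMapRight]

theorem tensorMapRight_id (t : Tensor R A M) : tensorMapRight A LinearMap.id t = t :=
  DFunLike.congr_fun (g := AddMonoidHom.id _) (tensor_hom_ext fun a m => by simp) t

theorem tensorMapRight_comp (g : N →ₗ[R] L) (h : M →ₗ[R] N) (t : Tensor R A M) :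
    tensorMapRight A (g ∘ₗ h) t = tensorMapRight A g (tensorMapRight A h t) :=
  DFunLike.congr_fun (g := (tensorMapRight A g).comp (tensorMapRight A h))
    (tensor_hom_ext fun a m => by simp) t

theorem tensorMapRight_zero (t : Tensor R A M) : tensorMapRight A (0 : M →ₗ[R] N) t = 0 :=
  DFunLike.congr_fun (g := 0)
    (tensor_hom_ext fun a m => by simpa using tmul_add (R := R) (M := N) a 0 0) t

theorem tensorMapRight_add (g h : M →ₗ[R] N) (t : Tensor R A M) :
    tensorMapRight A (g + h) t = tensorMapRight A g t + tensorMapRight A h t :=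
  DFunLike.congr_fun (g := tensorMapRight A g + tensorMapRight A h)
    (tensor_hom_ext fun a m => by simp [tmul_add]) t

theorem tensorMapRight_sum {J : Type*} (s : Finset J) (g : J → M →ₗ[R] N) (t : Tensor R A M) :
    tensorMapRight A (∑ j ∈ s, g j) t = ∑ j ∈ s, tensorMapRight A (g j) t := by
  classical
  induction s using Finset.induction_on with
  | empty => simpa using tensorMapRight_zero t
  | insert j s hj ih => rw [Finset.sum_insert hj, Finset.sum_insert hj, tensorMapRight_add, ih]

theorem tensorMap_tensorMapRight (f : A →ₗ[Rᵐᵒᵖ] B) (g : M →ₗ[R] N) (t : Tensor R A M) :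
    tensorMap f N (tensorMapRight A g t) = tensorMapRight B g (tensorMap f M t) :=
  DFunLike.congr_fun (f := (tensorMap f N).comp (tensorMapRight A g))
    (g := (tensorMapRight B g).comp (tensorMap f M))
    (tensor_hom_ext fun a m => by simp) t

theorem tensorMap_comp {C : Type u} [AddCommGroup C] [Module Rᵐᵒᵖ C] (f : B →ₗ[Rᵐᵒᵖ] C)
    (g : A →ₗ[Rᵐᵒᵖ] B) (t : Tensor R A M) :
    tensorMap (f ∘ₗ g) M t = tensorMap f M (tensorMap g M t) :=
  DFunLike.congr_fun (g := (tensorMap f M).comp (tensorMap g M))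
    (tensor_hom_ext fun a m => by simp) t

/-- Tensor products commute with directed unions: an element of `A ⊗ N` that vanishes in `A ⊗ P`,
where `P` is the union of a directed set of submodules, vanishes in some member of the set. -/
theorem exists_tensorMapRight_inclusion_eq_zero {S : Set (Submodule R M)}
    (hS : DirectedOn (· ≤ ·) S) {P : Submodule R M} (hle : ∀ N ∈ S, N ≤ P)
    (hP : ∀ m ∈ P, ∃ N ∈ S, m ∈ N) {N : Submodule R M} (hN : N ∈ S) (t : Tensor R A N)
    (ht : tensorMapRight A (Submodule.inclusion (hle N hN)) t = 0) :
    ∃ N' ∈ S, ∃ h : N ≤ N', tensorMapRight A (Submodule.inclusion h) t = 0 := by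
  classical
  have : Nonempty S := ⟨⟨N, hN⟩⟩
  have : IsDirectedOrder S := ⟨fun a b => by
    obtain ⟨c, hc, hac, hbc⟩ := hS a a.2 b b.2
    exact ⟨⟨c, hc⟩, hac, hbc⟩⟩
  let G : S → Type u := fun K => Tensor R A K.1
  let f : ∀ K L : S, K ≤ L → G K →+ G L := fun K L h =>
    tensorMapRight A (Submodule.inclusion (show K.1 ≤ L.1 from h))
  have : DirectedSystem G (fun i j h => f i j h) :=
    { map_self := fun K t => tensorMapRight_id t
      map_map := fun K L L' h h' t => (tensorMapRight_comp _ _ t).symm }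
  -- It suffices that `t` vanishes in the direct limit `D` of the groups `A ⊗ K`, because vanishing
  -- there is detected at a finite stage. The map `Ψ` from `A ⊗ P` to `D` transfers `ht`.
  let D := AddCommGroup.DirectLimit G f
  let of : ∀ K, G K →+ D := AddCommGroup.DirectLimit.of G f
  have of_eq (K L : S) (a : A) (m : M) (hK : m ∈ K.1) (hL : m ∈ L.1) :
      of K (tmul R a ⟨m, hK⟩) = of L (tmul R a ⟨m, hL⟩) := by
    obtain ⟨L', h1, h2⟩ := exists_ge_ge K L
    have e1 := AddCommGroup.DirectLimit.of_f (G := G) (f := f) (hij := h1)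
      (x := tmul R a ⟨m, hK⟩)
    have e2 := AddCommGroup.DirectLimit.of_f (G := G) (f := f) (hij := h2)
      (x := tmul R a ⟨m, hL⟩)
    refine e1.symm.trans (Eq.trans ?_ e2)
    simp only [f]
    rfl
  have hP' : ∀ m : P, ∃ K : S, m.1 ∈ K.1 := fun m => by
    obtain ⟨K, hK, h⟩ := hP m m.2
    exact ⟨⟨K, hK⟩, h⟩
  -- `κ m` is an arbitrary member containing `m`; by `of_eq` the class in `D` does not depend on
  -- this choice, which makes `Ψ` additive and balanced.
  choose κ hκ using hP'
  let Ψ : Tensor R A P →+ D := tensorLift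
    (AddMonoidHom.mk' (fun a => AddMonoidHom.mk' (fun m => of (κ m) (tmul R a ⟨m, hκ m⟩))
      (by
        intro m m'
        obtain ⟨K, h1, h2⟩ := exists_ge_ge (κ m) (κ m')
        have k1 : m.1 ∈ K.1 := h1 (hκ m)
        have k2 : m'.1 ∈ K.1 := h2 (hκ m')
        rw [of_eq (κ m) K a m.1 (hκ m) k1, of_eq (κ m') K a m'.1 (hκ m') k2,
          of_eq (κ (m + m')) K a (m + m').1 (hκ _) (K.1.add_mem k1 k2), ← map_add, ← tmul_add]
        rfl))
      (by
        intro a a'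
        ext m
        simp only [AddMonoidHom.mk'_apply, AddMonoidHom.add_apply, add_tmul, map_add]))
    (by
      intro a r m
      simp only [AddMonoidHom.mk'_apply]
      rw [of_eq (κ (r • m)) (κ m) a (r • m).1 (hκ _) ((κ m).1.smul_mem r (hκ m)), smul_tmul]
      rfl)
  have hΨ : Ψ.comp (tensorMapRight A (Submodule.inclusion (hle N hN))) = of ⟨N, hN⟩ := by
    refine tensor_hom_ext fun a m => ?_
    simp only [Ψ, AddMonoidHom.comp_apply, tensorMapRight_tmul, tensorLift_tmul,
      AddMonoidHom.mk'_apply]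
    exact of_eq _ ⟨N, hN⟩ a m.1 _ m.2
  have h0 : of ⟨N, hN⟩ t = 0 := by
    rw [← hΨ, AddMonoidHom.comp_apply, ht, map_zero]
  obtain ⟨K, hK, h⟩ := AddCommGroup.DirectLimit.of.zero_exact (G := G) (f := f) _ _ h0
  exact ⟨K.1, K.2, hK, h⟩

theorem exists_tensorMapRight_inclusion_eq {S : Set (Submodule R M)} (hne : S.Nonempty)
    (hS : DirectedOn (· ≤ ·) S) {P : Submodule R M} (hle : ∀ N ∈ S, N ≤ P)
    (hP : ∀ m ∈ P, ∃ N ∈ S, m ∈ N) (t : Tensor R A P) :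
    ∃ N, ∃ hN : N ∈ S, ∃ t' : Tensor R A N,
      tensorMapRight A (Submodule.inclusion (hle N hN)) t' = t := by
  induction t using tensor_induction with
  | zero =>
    obtain ⟨N, hN⟩ := hne
    exact ⟨N, hN, 0, map_zero _⟩
  | tmul a m =>
    obtain ⟨N, hN, h⟩ := hP m m.2
    exact ⟨N, hN, tmul R a ⟨m, h⟩, by rw [tensorMapRight_tmul]; rfl⟩
  | add x y hx hy =>
    obtain ⟨N, hN, t, rfl⟩ := hx
    obtain ⟨N', hN', t', rfl⟩ := hy
    obtain ⟨K, hK, h, h'⟩ := hS N hN N' hN'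
    refine ⟨K, hK, tensorMapRight A (Submodule.inclusion h) t +
      tensorMapRight A (Submodule.inclusion h') t', ?_⟩
    rw [map_add, ← tensorMapRight_comp, ← tensorMapRight_comp]
    rfl

end TensorBasics

end RelativeML

namespace RelativeML

/-! ### Mittag-Leffler modules: closure properties and projectives -/

section MittagLeffler

variable {R : Type u} [Ring R] {X : ModuleCat.{u} Rᵐᵒᵖ → Prop}
variable {M N : Type u} [AddCommGroup M] [Module R M] [AddCommGroup N] [Module R N]

theorem prodTensorMap_eq_zero_iff {I : Type u} {F : I → ModuleCat.{u} Rᵐᵒᵖ}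
    {t : Tensor R (∀ i, F i) M} :
    prodTensorMap F M t = 0 ↔ ∀ i, tensorMap (LinearMap.proj i) M t = 0 :=
  funext_iff

theorem mittagLeffler_iff :
    MittagLeffler X (ModuleCat.of R M) ↔ ∀ (I : Type u) (F : I → ModuleCat.{u} Rᵐᵒᵖ),
      (∀ i, X (F i)) → ∀ t : Tensor R (∀ i, F i) M,
        (∀ i, tensorMap (LinearMap.proj i : (∀ i, F i) →ₗ[Rᵐᵒᵖ] F i) M t = 0) → t = 0 := by
  refine forall₃_congr fun I F hF => ?_
  rw [injective_iff_map_eq_zero]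
  exact forall_congr' fun t => imp_congr_left prodTensorMap_eq_zero_iff

/-- If each element of `A ⊗ M` is reached, for every `A`, through endomorphisms of `M` factoring
through `X`-Mittag-Leffler modules, then `M` is `X`-Mittag-Leffler. -/
theorem mittagLeffler_of_factorization {J : Type*} (K : J → Type u) [∀ j, AddCommGroup (K j)]
    [∀ j, Module R (K j)] (hK : ∀ j, MittagLeffler X (ModuleCat.of R (K j)))
    (p : ∀ j, M →ₗ[R] K j) (s : ∀ j, K j →ₗ[R] M)
    (h : ∀ (A : Type u) [AddCommGroup A] [Module Rᵐᵒᵖ A] (t : Tensor R A M),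
      ∃ T : Finset J, tensorMapRight A (∑ j ∈ T, s j ∘ₗ p j) t = t) :
    MittagLeffler X (ModuleCat.of R M) := by
  refine mittagLeffler_iff.2 fun I F hF t ht => ?_
  obtain ⟨T, hT⟩ := h _ t
  rw [← hT, tensorMapRight_sum]
  refine Finset.sum_eq_zero fun j _ => ?_
  rw [tensorMapRight_comp, mittagLeffler_iff.1 (hK j) I F hF (tensorMapRight _ (p j) t), map_zero]
  intro i
  rw [tensorMap_tensorMapRight, ht, map_zero]

theorem MittagLeffler.retract (hM : MittagLeffler X (ModuleCat.of R M)) (s : N →ₗ[R] M)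
    (r : M →ₗ[R] N) (h : r ∘ₗ s = LinearMap.id) : MittagLeffler X (ModuleCat.of R N) :=
  mittagLeffler_of_factorization (J := Unit) (fun _ => M) (fun _ => hM) (fun _ => s) (fun _ => r)
    fun A _ _ t => ⟨{()}, by rw [Finset.sum_singleton, h, tensorMapRight_id]⟩

theorem MittagLeffler.prod (hM : MittagLeffler X (ModuleCat.of R M))
    (hN : MittagLeffler X (ModuleCat.of R N)) : MittagLeffler X (ModuleCat.of R (M × N)) := by
  refine mittagLeffler_iff.2 fun I F hF t ht => ?_
  have h : LinearMap.inl R M N ∘ₗ LinearMap.fst R M N +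
      LinearMap.inr R M N ∘ₗ LinearMap.snd R M N = LinearMap.id := by
    ext <;> simp
  rw [← tensorMapRight_id t, ← h, tensorMapRight_add, tensorMapRight_comp, tensorMapRight_comp,
    mittagLeffler_iff.1 hM I F hF (tensorMapRight _ (LinearMap.fst R M N) t),
    mittagLeffler_iff.1 hN I F hF (tensorMapRight _ (LinearMap.snd R M N) t), map_zero, map_zero,
    add_zero]
  all_goals
    intro i
    rw [tensorMap_tensorMapRight, ht, map_zero]

theorem mittagLeffler_self : MittagLeffler X (ModuleCat.of R R) := by
  refine mittagLeffler_iff.2 fun I F hF t ht => ?_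
  -- The multiplication map `A ⊗ R → A` has inverse `a ↦ a ⊗ 1` and is natural in `A`, so vanishing
  -- can be tested in the product itself.
  let μ (A : Type u) [AddCommGroup A] [Module Rᵐᵒᵖ A] : Tensor R A R →+ A :=
    tensorLift
      (AddMonoidHom.mk' (fun a => AddMonoidHom.mk' (fun r => MulOpposite.op r • a)
        fun r r' => by rw [MulOpposite.op_add, add_smul]) fun a a' => by
          ext r
          exact smul_add _ _ _)
      fun a r m => by
        simp only [AddMonoidHom.mk'_apply, smul_smul, smul_eq_mul, MulOpposite.op_mul]
  have hμ (A : Type u) [AddCommGroup A] [Module Rᵐᵒᵖ A] (t : Tensor R A R) :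
      tmul R (μ A t) (1 : R) = t := by
    induction t using tensor_induction with
    | zero => simpa using add_tmul (R := R) (0 : A) 0 (1 : R)
    | tmul a r =>
      simp only [μ, tensorLift_tmul, AddMonoidHom.mk'_apply, smul_tmul, smul_eq_mul, mul_one]
    | add x y hx hy => rw [map_add, add_tmul, hx, hy]
  have hnat (i : I) : (LinearMap.proj i : (∀ i, F i) →ₗ[Rᵐᵒᵖ] F i).toAddMonoidHom.comp (μ _) =
      (μ _).comp (tensorMap (LinearMap.proj i) R) :=
    tensor_hom_ext fun a m => by simp [μ]
  have h0 : μ _ t = 0 := funext fun i => by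
    have := DFunLike.congr_fun (hnat i) t
    simp only [AddMonoidHom.comp_apply, ht i, map_zero] at this
    exact this
  rw [← hμ _ t, h0]
  simpa using add_tmul (R := R) (0 : ∀ i, F i) 0 (1 : R)

theorem mittagLeffler_finsupp (J : Type u) : MittagLeffler X (ModuleCat.of R (J →₀ R)) := by
  classical
  refine mittagLeffler_of_factorization (J := J) (fun _ => R) (fun _ => mittagLeffler_self)
    Finsupp.lapply Finsupp.lsingle fun A _ _ t => ?_
  -- Asking for all larger finite sets lets two summands share the union of their sets.
  suffices ∃ T : Finset J, ∀ T', T ⊆ T' →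
      tensorMapRight A (∑ j ∈ T', (Finsupp.lsingle j : R →ₗ[R] J →₀ R) ∘ₗ Finsupp.lapply j) t = t by
    obtain ⟨T, hT⟩ := this
    exact ⟨T, hT T subset_rfl⟩
  induction t using tensor_induction with
  | zero => exact ⟨∅, fun _ _ => map_zero _⟩
  | tmul a m =>
    refine ⟨m.support, fun T' hT' => ?_⟩
    rw [tensorMapRight_tmul]
    congr 1
    simp only [LinearMap.sum_apply, LinearMap.comp_apply, Finsupp.lapply_apply,
      Finsupp.lsingle_apply]
    exact (Finsupp.sum_of_support_subset m hT' _ fun _ _ => Finsupp.single_zero _).symm.trans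
      m.sum_single
  | add x y hx hy =>
    obtain ⟨T, hT⟩ := hx
    obtain ⟨T', hT'⟩ := hy
    refine ⟨T ∪ T', fun U hU => ?_⟩
    rw [map_add, hT U (Finset.union_subset_left hU), hT' U (Finset.union_subset_right hU)]

theorem mittagLeffler_of_projective [Module.Projective R M] :
    MittagLeffler X (ModuleCat.of R M) := by
  obtain ⟨s, hs⟩ := Module.projective_def'.1 ‹Module.Projective R M›
  exact (mittagLeffler_finsupp M).retract s _ hs

/-! ### Dense systems of Mittag-Leffler submodules -/

theorem mk_lt_aleph_one_iff {α : Type u} {s : Set α} : #s < ℵ₁ ↔ s.Countable := by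
  rw [← Cardinal.succ_aleph0, Order.lt_succ_iff, Cardinal.le_aleph0_iff_set_countable]

theorem omega0_lt_ord_aleph_one : Ordinal.omega0.{u} < (ℵ₁ : Cardinal.{u}).ord := by
  rw [← Cardinal.ord_aleph0, Cardinal.ord_lt_ord]
  exact Cardinal.aleph0_lt_aleph_one

theorem IsDenseSystem.exists_mem {Y : ModuleCat.{u} R → Prop} {M : ModuleCat.{u} R}
    {S : Set (Submodule R M)} (hS : IsDenseSystem ℵ₁ Y M S) (m : M) : ∃ N ∈ S, m ∈ N := by
  obtain ⟨N, hN, h⟩ := hS.exists_ge {m} (mk_lt_aleph_one_iff.2 (Set.countable_singleton m))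
  exact ⟨N, hN, h rfl⟩

/-- A member of a dense system in which an element of `(∏ i, F i) ⊗ M` with vanishing components
has a preimage with vanishing components. -/
theorem exists_forall_tensorMap_eq_zero {M : ModuleCat.{u} R} {S : Set (Submodule R M)}
    (hS : IsDenseSystem ℵ₁ (MittagLeffler X) M S) {I : Type u} {F : I → ModuleCat.{u} Rᵐᵒᵖ}
    (hF : ∀ i, X (F i)) {N₀ : Submodule R M} (hN₀ : N₀ ∈ S) (t : Tensor R (∀ i, F i) N₀)
    (ht : ∀ i, tensorMap (LinearMap.proj i : (∀ i, F i) →ₗ[Rᵐᵒᵖ] F i) (⊤ : Submodule R M)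
      (tensorMapRight _ (Submodule.inclusion le_top) t) = 0) :
    ∃ N ∈ S, ∃ h : N₀ ≤ N, ∀ i, tensorMap (LinearMap.proj i : (∀ i, F i) →ₗ[Rᵐᵒᵖ] F i) N
      (tensorMapRight _ (Submodule.inclusion h) t) = 0 := by
  by_contra! hcon
  let c (i : I) (N : Submodule R M) (h : N₀ ≤ N) : Tensor R (F i) N :=
    tensorMapRight (F i) (Submodule.inclusion h) (tensorMap (LinearMap.proj i) N₀ t)
  have c_mono (i : I) {N N' : Submodule R M} (h : N₀ ≤ N) (h' : N ≤ N') (h0 : c i N h = 0) :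
      c i N' (h.trans h') = 0 := by
    have : c i N' (h.trans h') = tensorMapRight (F i) (Submodule.inclusion h') (c i N h) :=
      tensorMapRight_comp (Submodule.inclusion h') (Submodule.inclusion h) _
    rw [this, h0, map_zero]
  -- Every component dies over `⊤`, the directed union of `S`, so a component surviving over `N`
  -- dies over some larger member.
  have step (N : {N : Submodule R M // N ∈ S ∧ N₀ ≤ N}) :
      ∃ N' : {N : Submodule R M // N ∈ S ∧ N₀ ≤ N}, N.1 ≤ N'.1 ∧
        ∃ i, c i N.1 N.2.2 ≠ 0 ∧ c i N'.1 N'.2.2 = 0 := by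
    obtain ⟨N, hN, h⟩ := N
    obtain ⟨i, hi⟩ := hcon N hN h
    rw [tensorMap_tensorMapRight] at hi
    have hi0 := ht i
    rw [tensorMap_tensorMapRight] at hi0
    obtain ⟨N', hN', h', h0⟩ := exists_tensorMapRight_inclusion_eq_zero hS.directed
      (P := ⊤) (fun _ _ => le_top) (fun m _ => hS.exists_mem m) hN (c i N h) (by
          rw [← hi0]
          exact (tensorMapRight_comp _ _ _).symm)
    refine ⟨⟨N', hN', h.trans h'⟩, h', i, hi, ?_⟩
    rw [← h0]
    exact tensorMapRight_comp (Submodule.inclusion h') (Submodule.inclusion h) _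
  choose next hnext i hi hi' using step
  let Q : ℕ → {N : Submodule R M // N ∈ S ∧ N₀ ≤ N} := fun k => next^[k] ⟨N₀, hN₀, le_rfl⟩
  have Q_succ (k : ℕ) : Q (k + 1) = next (Q k) := Function.iterate_succ_apply' _ _ _
  have Q_mono : Monotone fun k => (Q k).1 := monotone_nat_of_le_succ fun k => by
    rw [Q_succ]
    exact hnext _
  -- The only use of chain closure: length `ω`, with the sequence reindexed by the ordinals below
  -- `ω`.
  have hω : (⨆ k, (Q k).1) ∈ S := by
    have hlt (α : Set.Iio Ordinal.omega0.{u}) : ∃ n : ℕ, α.1 = n := Ordinal.lt_omega0.1 α.2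
    choose d hd using hlt
    have := hS.iSup_mem Ordinal.omega0 Ordinal.omega0_pos
      omega0_lt_ord_aleph_one (fun α => (Q (d α)).1)
      (fun α β hαβ => Q_mono (by
        have : (d α : Ordinal.{u}) ≤ d β := by rw [← hd, ← hd]; exact hαβ
        exact_mod_cast this)) fun α => (Q (d α)).2.1
    convert this using 1
    refine le_antisymm (iSup_le fun k => ?_) (iSup_le fun α => le_iSup (fun k => (Q k).1) _)
    have hk : d ⟨(k : Ordinal.{u}), Ordinal.natCast_lt_omega0 k⟩ = k :=
      Nat.cast_injective (R := Ordinal.{u}) (hd ⟨(k : Ordinal.{u}), _⟩).symm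
    exact le_iSup_of_le ⟨(k : Ordinal.{u}), Ordinal.natCast_lt_omega0 k⟩ (by rw [hk])
  set P : Submodule R M := ⨆ k, (Q k).1 with hPdef
  have hQP (k : ℕ) : (Q k).1 ≤ P := le_iSup (fun k => (Q k).1) k
  have hP0 : N₀ ≤ P := hQP 0
  -- Only the components dying over `P` are kept, so that the Mittag-Leffler property of `P`
  -- applies; all indices `i (Q k)` are among them.
  let I' : Type u := {i : I // c i P hP0 = 0}
  let res : (∀ i, F i) →ₗ[Rᵐᵒᵖ] ∀ i : I', F i.1 := LinearMap.pi fun i => LinearMap.proj i.1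
  have hres : tensorMapRight (∀ i : I', F i.1) (Submodule.inclusion hP0)
      (tensorMap res N₀ t) = 0 := by
    refine mittagLeffler_iff.1 (hS.mem_class P hω) I' (fun i => F i.1) (fun i => hF i.1) _
      fun j => ?_
    rw [tensorMap_tensorMapRight, ← tensorMap_comp]
    exact j.2
  obtain ⟨_, ⟨k, rfl⟩, hk, h0⟩ := exists_tensorMapRight_inclusion_eq_zero
    (S := Set.range fun k => (Q k).1) (P := P) (directedOn_range.2 Q_mono.directed_le)
    (by rintro _ ⟨k, rfl⟩; exact hQP k)
    (fun m hm => by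
      obtain ⟨k, hk⟩ := (Submodule.mem_iSup_of_directed _ Q_mono.directed_le).1 hm
      exact ⟨_, ⟨k, rfl⟩, hk⟩) ⟨0, rfl⟩ (tensorMap res N₀ t) hres
  have hik : c (i (Q k)) P hP0 = 0 := by
    refine c_mono _ _ ?_ (hi' (Q k))
    rw [← Q_succ]
    exact hQP (k + 1)
  -- The restricted tensor is zero over `Q k`, hence so is its component at `i (Q k)`, which was
  -- chosen to be nonzero there.
  refine hi (Q k) ?_
  let j : I' := ⟨i (Q k), hik⟩
  have key : tensorMap (LinearMap.proj j : (∀ i : I', F i.1) →ₗ[Rᵐᵒᵖ] F j.1) (Q k).1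
      (tensorMapRight _ (Submodule.inclusion (Q k).2.2) (tensorMap res N₀ t)) =
        c (i (Q k)) (Q k).1 (Q k).2.2 := by
    rw [tensorMap_tensorMapRight, ← tensorMap_comp]
    rfl
  rw [← key]
  exact (congrArg _ h0).trans (map_zero _)

theorem mittagLeffler_of_isFree {M : ModuleCat.{u} R} (hM : IsFree ℵ₁ (MittagLeffler X) M) :
    MittagLeffler X M := by
  obtain ⟨S, hS⟩ := hM
  suffices MittagLeffler X (ModuleCat.of R (⊤ : Submodule R M)) from
    this.retract (N := M) Submodule.topEquiv.symm.toLinearMap Submodule.topEquiv.toLinearMap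
      (by ext; rfl)
  refine mittagLeffler_iff.2 fun I F hF t ht => ?_
  obtain ⟨N₁, hN₁, -⟩ := hS.exists_mem 0
  obtain ⟨N₀, hN₀, t, rfl⟩ := exists_tensorMapRight_inclusion_eq ⟨N₁, hN₁⟩ hS.directed
    (P := ⊤) (fun _ _ => le_top) (fun m _ => hS.exists_mem m) t
  obtain ⟨N, hN, h, h0⟩ := exists_forall_tensorMap_eq_zero hS hF hN₀ t ht
  have := mittagLeffler_iff.1 (hS.mem_class N hN) I F hF _ h0
  have key := tensorMapRight_comp (A := ∀ i, F i)
    (Submodule.inclusion (le_top : N ≤ ⊤)) (Submodule.inclusion h) t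
  rw [this, map_zero] at key
  exact key

end MittagLeffler

end RelativeML

namespace RelativeML

/-! ### Relative projective dimension and independence of the resolution -/

section Dimension

variable {R : Type u} [Ring R] {Y : ModuleCat.{u} R → Prop}
variable {M N K P P' : Type u} [AddCommGroup M] [Module R M] [AddCommGroup N] [Module R N]
  [AddCommGroup K] [Module R K] [AddCommGroup P] [Module R P] [AddCommGroup P'] [Module R P']

theorem nonempty_equiv_prod_of_exact {E : Type u} [AddCommGroup E] [Module R E]
    [Module.Projective R P] {i : K →ₗ[R] E} {p : E →ₗ[R] P} (hi : Function.Injective i)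
    (hp : Function.Surjective p) (h : Function.Exact i p) : Nonempty (E ≃ₗ[R] K × P) := by
  obtain ⟨s, hs⟩ := Module.projective_lifting_property p LinearMap.id hp
  exact ⟨(h.splitSurjectiveEquiv hi ⟨s, hs⟩).1⟩

/-- Schanuel's lemma. -/
theorem schanuel [Module.Projective R P] [Module.Projective R P'] {p : P →ₗ[R] M}
    {p' : P' →ₗ[R] M} (hp : Function.Surjective p) (hp' : Function.Surjective p') :
    Nonempty ((LinearMap.ker p × P') ≃ₗ[R] LinearMap.ker p' × P) := by
  -- The pullback of `p` and `p'`: its projections onto `P'` and `P` have kernels `ker p` and `ker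
  -- p'`, and both split.
  let E : Submodule R (P × P') :=
    LinearMap.ker (p ∘ₗ LinearMap.fst R P P' - p' ∘ₗ LinearMap.snd R P P')
  have hE (x : P × P') : x ∈ E ↔ p x.1 = p' x.2 := by
    simp [E, sub_eq_zero]
  let i : LinearMap.ker p →ₗ[R] E :=
    (LinearMap.inl R P P' ∘ₗ (LinearMap.ker p).subtype).codRestrict E fun k => by
      simp [hE]
  let i' : LinearMap.ker p' →ₗ[R] E :=
    (LinearMap.inr R P P' ∘ₗ (LinearMap.ker p').subtype).codRestrict E fun k => by
      simp [hE]
  obtain ⟨e⟩ := nonempty_equiv_prod_of_exact (i := i) (p := LinearMap.snd R P P' ∘ₗ E.subtype)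
    (fun x y h => by
      have := congrArg (fun z : E => z.1.1) h
      exact Subtype.ext this)
    (fun y => by
      obtain ⟨x, hx⟩ := hp (p' y)
      exact ⟨⟨(x, y), (hE _).2 hx⟩, rfl⟩)
    (by
      rintro ⟨⟨x, y⟩, h⟩
      constructor
      · rintro (rfl : y = 0)
        have hx : p x = 0 := by simpa using (hE _).1 h
        exact ⟨⟨x, hx⟩, rfl⟩
      · rintro ⟨k, hk⟩
        exact (congrArg (fun z : E => z.1.2) hk).symm)
  obtain ⟨e'⟩ := nonempty_equiv_prod_of_exact (i := i') (p := LinearMap.fst R P P' ∘ₗ E.subtype)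
    (fun x y h => by
      have := congrArg (fun z : E => z.1.2) h
      exact Subtype.ext this)
    (fun x => by
      obtain ⟨y, hy⟩ := hp' (p x)
      exact ⟨⟨(x, y), (hE _).2 hy.symm⟩, rfl⟩)
    (by
      rintro ⟨⟨x, y⟩, h⟩
      constructor
      · rintro (rfl : x = 0)
        have hy : p' y = 0 := by simpa using ((hE _).1 h).symm
        exact ⟨⟨y, hy⟩, rfl⟩
      · rintro ⟨k, hk⟩
        exact (congrArg (fun z : E => z.1.1) hk).symm)
  exact ⟨e.symm.trans e'⟩

/-- The module `M` has `Y`-projective dimension at most `n`, as a recursion on `n`. -/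
def SyzygyIn (Y : ModuleCat.{u} R → Prop) :
    ℕ → ∀ (M : Type u) [AddCommGroup M] [Module R M], Prop
  | 0, M, _, _ => Y (ModuleCat.of R M)
  | n + 1, M, _, _ => ∃ (P : Type u) (_ : AddCommGroup P) (_ : Module R P) (p : P →ₗ[R] M),
      Module.Projective R P ∧ Function.Surjective p ∧ SyzygyIn Y n (LinearMap.ker p)

/-- A class of modules closed under isomorphisms and under adding and removing projective direct
summands. -/
structure IsStable (Y : ModuleCat.{u} R → Prop) : Prop where
  congr : ∀ {M N : Type u} [AddCommGroup M] [Module R M] [AddCommGroup N] [Module R N],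
    (M ≃ₗ[R] N) → Y (ModuleCat.of R M) → Y (ModuleCat.of R N)
  prod_iff : ∀ {M P : Type u} [AddCommGroup M] [Module R M] [AddCommGroup P] [Module R P]
    [Module.Projective R P], Y (ModuleCat.of R (M × P)) ↔ Y (ModuleCat.of R M)

theorem isStable_mittagLeffler (X : ModuleCat.{u} Rᵐᵒᵖ → Prop) :
    IsStable (R := R) (MittagLeffler X) where
  congr e h := h.retract e.symm.toLinearMap e.toLinearMap (by ext; simp)
  prod_iff := ⟨fun h => h.retract (LinearMap.inl _ _ _) (LinearMap.fst _ _ _) (by ext; simp),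
    fun h => h.prod mittagLeffler_of_projective⟩

theorem SyzygyIn.congr (hY : IsStable Y) {n : ℕ} (e : M ≃ₗ[R] N) (h : SyzygyIn Y n M) :
    SyzygyIn Y n N := by
  cases n with
  | zero => exact hY.congr e h
  | succ n =>
    obtain ⟨P, _, _, p, hP, hp, h⟩ := h
    refine ⟨P, _, _, e.toLinearMap ∘ₗ p, hP, e.surjective.comp hp, ?_⟩
    rwa [LinearEquiv.ker_comp]

theorem SyzygyIn.of_exact (hY : IsStable Y) {n : ℕ} [hP : Module.Projective R P] {i : K →ₗ[R] P}
    {p : P →ₗ[R] M} (hi : Function.Injective i) (hp : Function.Surjective p)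
    (h : Function.Exact i p) (hK : SyzygyIn Y n K) : SyzygyIn Y (n + 1) M :=
  ⟨P, _, _, p, hP, hp, hK.congr hY
    ((LinearEquiv.ofInjective i hi).trans (LinearEquiv.ofEq _ _ h.linearMap_ker_eq.symm))⟩

/-- Projective summands can be absorbed into the cover or its kernel; this cancels the summands that
Schanuel's lemma introduces. -/
theorem syzygyIn_prod_iff (hY : IsStable Y) {n : ℕ} [hP : Module.Projective R P] :
    SyzygyIn Y n (M × P) ↔ SyzygyIn Y n M := by
  induction n generalizing M P with
  | zero => exact hY.prod_iff
  | succ n ih =>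
    constructor
    · rintro ⟨Q, _, _, q, hQ, hq, h⟩
      -- A cover `q` of `M × P` also covers `M`, and the new kernel is an extension of `P` by `ker
      -- q`, which splits.
      have hker : LinearMap.ker q ≤ LinearMap.ker (LinearMap.fst R M P ∘ₗ q) := fun x hx => by
        rw [LinearMap.mem_ker] at hx ⊢
        rw [LinearMap.comp_apply, hx, map_zero]
      obtain ⟨e⟩ := nonempty_equiv_prod_of_exact (i := Submodule.inclusion hker)
        (p := LinearMap.snd R M P ∘ₗ q ∘ₗ (LinearMap.ker (LinearMap.fst R M P ∘ₗ q)).subtype)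
        (Submodule.inclusion_injective hker)
        (fun y => by
          obtain ⟨x, hx⟩ := hq (0, y)
          exact ⟨⟨x, by simp [hx]⟩, by simp [hx]⟩)
        (by
          rintro ⟨x, hx⟩
          constructor
          · intro h
            exact ⟨⟨x, Prod.ext hx h⟩, rfl⟩
          · rintro ⟨k, hk⟩
            obtain rfl : k.1 = x := congrArg Subtype.val hk
            exact congrArg Prod.snd k.2)
      exact ⟨Q, _, _, LinearMap.fst R M P ∘ₗ q, hQ, Prod.fst_surjective.comp hq,
        ((ih (P := P)).2 h).congr hY e.symm⟩
    · rintro ⟨Q, _, _, q, hQ, hq, h⟩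
      refine h.of_exact hY (P := Q × P) (i := LinearMap.inl R Q P ∘ₗ (LinearMap.ker q).subtype)
        (p := q.prodMap LinearMap.id) (LinearMap.inl_injective.comp Subtype.val_injective)
        (hq.prodMap Function.surjective_id) ?_
      rintro ⟨x, y⟩
      constructor
      · intro h
        obtain ⟨h1, rfl : y = 0⟩ := Prod.ext_iff.1 h
        exact ⟨⟨x, h1⟩, rfl⟩
      · rintro ⟨k, hk⟩
        rw [← hk]
        exact Prod.ext k.2 rfl

/-- The kernel of any projective cover of a module of `Y`-projective dimension at most `n + 1` has
`Y`-projective dimension at most `n`. -/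
theorem SyzygyIn.of_succ (hY : IsStable Y) {n : ℕ} [Module.Projective R P] {i : K →ₗ[R] P}
    {p : P →ₗ[R] M} (hi : Function.Injective i) (hp : Function.Surjective p)
    (h : Function.Exact i p) (hM : SyzygyIn Y (n + 1) M) : SyzygyIn Y n K := by
  obtain ⟨Q, _, _, q, hQ, hq, hL⟩ := hM
  obtain ⟨e⟩ := schanuel hp hq
  exact ((syzygyIn_prod_iff hY).1 (((syzygyIn_prod_iff hY (P := P)).2 hL).congr hY e.symm)).congr hY
    ((LinearEquiv.ofEq _ _ h.linearMap_ker_eq).trans (LinearEquiv.ofInjective i hi).symm)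

/-! ### Projective resolutions and the recursive form of the dimension -/

theorem exact_comp_of_surjective {p : P →ₗ[R] M} {i : K →ₗ[R] P} {q : N →ₗ[R] K}
    (h : Function.Exact i p) (hq : Function.Surjective q) : Function.Exact (i ∘ₗ q) p :=
  hq.comp_exact_iff_exact.2 h

theorem exact_comp_of_injective {p : P →ₗ[R] M} {i : K →ₗ[R] P} {j : M →ₗ[R] N}
    (h : Function.Exact i p) (hj : Function.Injective j) : Function.Exact i (j ∘ₗ p) :=
  h.comp_injective j hj (map_zero j)

/-- The `n`-th kernel of the canonical free resolution of `M`. -/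
noncomputable def freeKernel (M : ModuleCat.{u} R) : ℕ → ModuleCat.{u} R
  | 0 => M
  | n + 1 => ModuleCat.of R (LinearMap.ker
      (Finsupp.linearCombination R (id : freeKernel M n → freeKernel M n)))

/-- The `n`-th cover of the canonical free resolution of `M`. -/
noncomputable def freeAug (M : ModuleCat.{u} R) (n : ℕ) :
    (freeKernel M n →₀ R) →ₗ[R] freeKernel M n :=
  Finsupp.linearCombination R id

theorem freeAug_surjective (M : ModuleCat.{u} R) (n : ℕ) : Function.Surjective (freeAug M n) :=
  Finsupp.linearCombination_id_surjective R _

/-- The inclusion of the `(n+1)`-st kernel of the canonical free resolution of `M`. -/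
noncomputable def freeIncl (M : ModuleCat.{u} R) (n : ℕ) :
    freeKernel M (n + 1) →ₗ[R] (freeKernel M n →₀ R) :=
  (LinearMap.ker (Finsupp.linearCombination R (id : freeKernel M n → freeKernel M n))).subtype

theorem freeIncl_injective (M : ModuleCat.{u} R) (n : ℕ) : Function.Injective (freeIncl M n) :=
  Subtype.val_injective

theorem exact_freeIncl_freeAug (M : ModuleCat.{u} R) (n : ℕ) :
    Function.Exact (freeIncl M n) (freeAug M n) :=
  LinearMap.exact_subtype_ker_map _

/-- The canonical free resolution of `M`. -/
noncomputable def freeRes (M : ModuleCat.{u} R) : ProjRes M where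
  P i := ModuleCat.of R (freeKernel M i →₀ R)
  d i := freeIncl M i ∘ₗ freeAug M (i + 1)
  aug := freeAug M 0
  projective i := inferInstanceAs (Module.Projective R (freeKernel M i →₀ R))
  aug_surjective := freeAug_surjective M 0
  exact_zero := exact_comp_of_surjective (exact_freeIncl_freeAug M 0) (freeAug_surjective M 1)
  exact_succ i := exact_comp_of_injective (exact_comp_of_surjective
    (exact_freeIncl_freeAug M (i + 1)) (freeAug_surjective M (i + 2))) (freeIncl_injective M i)

/-- The resolution of the kernel of the augmentation obtained by dropping `P 0`. -/
def ProjRes.tail {M : ModuleCat.{u} R} (Q : ProjRes M) :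
    ProjRes (ModuleCat.of R (LinearMap.ker Q.aug)) where
  P i := Q.P (i + 1)
  d i := Q.d (i + 1)
  aug := (Q.d 0).codRestrict (LinearMap.ker Q.aug) fun x => Q.exact_zero.apply_apply_eq_zero x
  projective i := Q.projective (i + 1)
  aug_surjective := by
    rintro ⟨x, hx⟩
    obtain ⟨y, rfl⟩ := (Q.exact_zero x).1 hx
    exact ⟨y, rfl⟩
  exact_zero := by
    rw [LinearMap.exact_iff]
    exact (LinearMap.ker_codRestrict _ _ _).trans (LinearMap.exact_iff.1 (Q.exact_succ 0))
  exact_succ i := Q.exact_succ (i + 1)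

theorem ProjRes.syzygy_tail {M : ModuleCat.{u} R} (Q : ProjRes M) (n : ℕ) :
    Q.tail.syzygy n = Q.syzygy (n + 1) := by
  match n with
  | 0 => rfl
  | 1 =>
    have h : LinearMap.ker Q.tail.aug = LinearMap.ker (Q.d 0) := LinearMap.ker_codRestrict _ _ _
    change ModuleCat.of R (LinearMap.ker Q.tail.aug) = ModuleCat.of R (LinearMap.ker (Q.d 0))
    exact congrArg (fun K : Submodule R (Q.P 1) => ModuleCat.of R K) h
  | n + 2 => rfl

/-- The resolution of `M` obtained from a projective cover `P → M` and a resolution of its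
kernel. -/
def ProjRes.splice {M P : ModuleCat.{u} R} (hP : Module.Projective R P) (p : P →ₗ[R] M)
    (hp : Function.Surjective p) (Q : ProjRes (ModuleCat.of R (LinearMap.ker p))) : ProjRes M where
  P
    | 0 => P
    | i + 1 => Q.P i
  d
    | 0 => (LinearMap.ker p).subtype ∘ₗ Q.aug
    | i + 1 => Q.d i
  aug := p
  projective
    | 0 => hP
    | i + 1 => Q.projective i
  aug_surjective := hp
  exact_zero := exact_comp_of_surjective (LinearMap.exact_subtype_ker_map p) Q.aug_surjective
  exact_succ
    | 0 => exact_comp_of_injective Q.exact_zero Subtype.val_injective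
    | i + 1 => Q.exact_succ i

theorem ProjRes.syzygy_splice {M P : ModuleCat.{u} R} (hP : Module.Projective R P) (p : P →ₗ[R] M)
    (hp : Function.Surjective p) (Q : ProjRes (ModuleCat.of R (LinearMap.ker p))) (n : ℕ) :
    (ProjRes.splice hP p hp Q).syzygy (n + 1) = Q.syzygy n := by
  match n with
  | 0 => rfl
  | 1 =>
    have h : LinearMap.ker ((LinearMap.ker p).subtype ∘ₗ Q.aug) = LinearMap.ker Q.aug :=
      LinearMap.ker_comp_of_ker_eq_bot _ (Submodule.ker_subtype _)
    exact congrArg (fun K : Submodule R (Q.P 0) => ModuleCat.of R K) h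
  | n + 2 => rfl

/-- Dropping `P 0` and splicing a cover onto a resolution of its kernel each shift syzygies by one.
For `n = 0` the free resolution only supplies the resolution that the definition requires. -/
theorem relProjDimLE_iff {n : ℕ} {M : ModuleCat.{u} R} :
    RelProjDimLE Y n M ↔ SyzygyIn Y n M := by
  induction n generalizing M with
  | zero => exact ⟨fun ⟨_, h⟩ => h, fun h => ⟨freeRes M, h⟩⟩
  | succ n ih =>
    constructor
    · rintro ⟨Q, hQ⟩
      rw [← Q.syzygy_tail] at hQ
      exact ⟨Q.P 0, _, _, Q.aug, Q.projective 0, Q.aug_surjective, ih.1 ⟨Q.tail, hQ⟩⟩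
    · rintro ⟨P, _, _, p, hP, hp, h⟩
      obtain ⟨Q, hQ⟩ := (ih (M := ModuleCat.of R (LinearMap.ker p))).2 h
      refine ⟨ProjRes.splice (P := ModuleCat.of R P) hP p hp Q, ?_⟩
      rwa [ProjRes.syzygy_splice]

end Dimension

/-! ### Transfer of dense systems to the kernel of a free cover -/

section Free

variable {R : Type u} [Ring R]

/-- A free cover of `M` with two generators for each element of `M`. -/
noncomputable def freeCover (R : Type u) [Ring R] (M : Type u) [AddCommGroup M] [Module R M] :
    (M × Bool →₀ R) →ₗ[R] M :=
  Finsupp.linearCombination R Prod.fst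

variable {M : Type u} [AddCommGroup M] [Module R M]

/-- The kernel of the free cover of `M`. -/
noncomputable def coverKernel (R : Type u) [Ring R] (M : Type u) [AddCommGroup M] [Module R M] :
    ModuleCat.{u} R :=
  ModuleCat.of R (LinearMap.ker (freeCover R M))

/-- The inclusion of the kernel of the free cover of `M`. -/
noncomputable def coverIncl (R : Type u) [Ring R] (M : Type u) [AddCommGroup M] [Module R M] :
    coverKernel R M →ₗ[R] (M × Bool →₀ R) :=
  (LinearMap.ker (freeCover R M)).subtype

theorem coverIncl_injective : Function.Injective (coverIncl R M) :=
  Subtype.val_injective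

theorem exact_coverIncl_freeCover : Function.Exact (coverIncl R M) (freeCover R M) :=
  LinearMap.exact_subtype_ker_map _

theorem freeCover_surjective : Function.Surjective (freeCover R M) := fun m =>
  ⟨Finsupp.single (m, true) 1, by simp [freeCover]⟩

/-- The elements of the kernel of the free cover of `M` supported on a submodule `N`. -/
noncomputable def kernelOn (N : Submodule R M) : Submodule R (coverKernel R M) :=
  (Finsupp.supported R R (Prod.fst ⁻¹' (N : Set M) : Set (M × Bool))).comap (coverIncl R M)

theorem mem_kernelOn {N : Submodule R M} {x : coverKernel R M} :
    x ∈ kernelOn N ↔ ∀ z ∈ (coverIncl R M x).support, z.1 ∈ N :=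
  Iff.rfl

/-- The reason for two generators per element: the difference of the two generators at `m` is a
relation whose support detects `m`, so `N` can be recovered from its relations. -/
theorem kernelOn_le_kernelOn {N N' : Submodule R M} : kernelOn N ≤ kernelOn N' ↔ N ≤ N' := by
  classical
  refine ⟨fun h m hm => ?_, fun h x hx z hz => h (hx hz)⟩
  -- Over the zero ring that difference is zero and detects nothing, but then `M` is zero as well.
  cases subsingleton_or_nontrivial R with
  | inl _ =>
    have := Module.subsingleton R M
    rw [Subsingleton.elim m 0]
    exact N'.zero_mem
  | inr _ =>
    obtain ⟨x, hx⟩ := (exact_coverIncl_freeCover (R := R) (M := M)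
      (Finsupp.single (m, true) 1 - Finsupp.single (m, false) 1)).1 (by simp [freeCover])
    have hxN : x ∈ kernelOn N := by
      rw [kernelOn, Submodule.mem_comap, hx]
      exact sub_mem (Finsupp.single_mem_supported R _ hm) (Finsupp.single_mem_supported R _ hm)
    exact mem_kernelOn.1 (h hxN) (m, true) (by simp [hx])

/-- Relations have finite support, and a finite subset of a directed union lies in one member. -/
theorem kernelOn_iSup {ι : Type*} [Nonempty ι] {g : ι → Submodule R M} (hg : Directed (· ≤ ·) g) :
    kernelOn (⨆ α, g α) = ⨆ α, kernelOn (g α) := by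
  refine le_antisymm (fun x hx => ?_)
    (iSup_le fun α => kernelOn_le_kernelOn.2 (le_iSup g α))
  have hsub : ((coverIncl R M x).support : Set (M × Bool)) ⊆ ⋃ α, Prod.fst ⁻¹' (g α : Set M) :=
    fun z hz => by
      have := mem_kernelOn.1 hx z hz
      rw [Submodule.mem_iSup_of_directed _ hg] at this
      exact Set.mem_iUnion.2 this
  obtain ⟨α, hα⟩ := Directed.exists_mem_subset_of_finset_subset_biUnion
    (fun α β => (hg α β).imp fun γ h => ⟨fun z hz => h.1 hz, fun z hz => h.2 hz⟩) hsub
  exact Submodule.mem_iSup_of_mem α hα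

/-- The kernel over `N` is the kernel of a projective cover of `N`. -/
theorem syzygyIn_kernelOn {Y : ModuleCat.{u} R → Prop} (hY : IsStable Y) {n : ℕ}
    {N : Submodule R M} (hN : SyzygyIn Y (n + 1) N) : SyzygyIn Y n (kernelOn N) := by
  let s : Set (M × Bool) := Prod.fst ⁻¹' (N : Set M)
  have : Module.Projective R (Finsupp.supported R R s) :=
    Module.Projective.of_equiv (Finsupp.supportedEquivFinsupp s).symm
  let i : kernelOn N →ₗ[R] Finsupp.supported R R s :=
    (coverIncl R M ∘ₗ (kernelOn N).subtype).codRestrict _ fun x => x.2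
  let p : Finsupp.supported R R s →ₗ[R] N :=
    (freeCover R M ∘ₗ (Finsupp.supported R R s).subtype).codRestrict N fun x =>
      N.sum_mem fun z hz => N.smul_mem _ (x.2 hz)
  refine hN.of_succ hY (P := Finsupp.supported R R s) (i := i) (p := p)
    (fun x y h => ?_) (fun m => ?_) fun x => ?_
  · exact Subtype.ext (coverIncl_injective (congrArg (fun z => z.1) h))
  · exact ⟨⟨Finsupp.single (m.1, true) 1, Finsupp.single_mem_supported R _ m.2⟩,
      Subtype.ext (by simp [p, freeCover])⟩
  · constructor
    · intro h
      obtain ⟨k, hk⟩ := (exact_coverIncl_freeCover x.1).1 (congrArg Subtype.val h)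
      refine ⟨⟨k, ?_⟩, Subtype.ext hk⟩
      rw [kernelOn, Submodule.mem_comap, hk]
      exact x.2
    · rintro ⟨k, rfl⟩
      exact Subtype.ext (exact_coverIncl_freeCover.apply_apply_eq_zero k.1)

/-- `kernelOn` embeds the order of submodules and commutes with directed unions, so it carries the
dense system over. -/
theorem isFree_coverKernel {Y : ModuleCat.{u} R → Prop} (hY : IsStable Y) {n : ℕ}
    {M : ModuleCat.{u} R} (hM : IsFree ℵ₁ (RelProjDimLE Y (n + 1)) M) :
    IsFree ℵ₁ (RelProjDimLE Y n) (coverKernel R M) := by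
  obtain ⟨S, hS⟩ := hM
  refine ⟨kernelOn '' S, ?_, ?_, ?_, ?_⟩
  · rintro _ ⟨N, hN, rfl⟩
    exact relProjDimLE_iff.2 (syzygyIn_kernelOn hY (relProjDimLE_iff.1 (hS.mem_class N hN)))
  · rintro _ ⟨N, hN, rfl⟩ _ ⟨N', hN', rfl⟩
    obtain ⟨L, hL, h, h'⟩ := hS.directed N hN N' hN'
    exact ⟨_, ⟨L, hL, rfl⟩, kernelOn_le_kernelOn.2 h, kernelOn_le_kernelOn.2 h'⟩
  · intro μ hμ hμκ f hf hfS
    choose g hgS hg using hfS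
    -- The chain is given among kernels; reflecting the order makes the chosen submodules of `M` a
    -- chain.
    have hmono : Monotone g := fun α β h => kernelOn_le_kernelOn.1 (by
      rw [hg, hg]
      exact hf h)
    have : Nonempty (Set.Iio μ) := ⟨⟨0, hμ⟩⟩
    refine ⟨_, hS.iSup_mem μ hμ hμκ g hmono hgS, ?_⟩
    rw [kernelOn_iSup hmono.directed_le]
    exact iSup_congr hg
  · intro T hT
    -- Countably many relations involve only countably many elements of `M`.
    have hc : (⋃ x ∈ T, Prod.fst '' ((coverIncl R M x).support : Set (M × Bool))).Countable :=
      (mk_lt_aleph_one_iff.1 hT).biUnion fun x _ =>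
        ((coverIncl R M x).support.finite_toSet.image Prod.fst).countable
    obtain ⟨N, hN, h⟩ := hS.exists_ge _ (mk_lt_aleph_one_iff.2 hc)
    exact ⟨_, ⟨N, hN, rfl⟩, fun x hx z hz => h (Set.mem_biUnion hx ⟨z, hz, rfl⟩)⟩

theorem relProjDimLE_of_isFree {X : ModuleCat.{u} Rᵐᵒᵖ → Prop} {n : ℕ} {M : ModuleCat.{u} R}
    (hM : IsFree ℵ₁ (RelProjDimLE (MittagLeffler X) n) M) :
    RelProjDimLE (MittagLeffler X) n M := by
  have hY := isStable_mittagLeffler (R := R) X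
  induction n generalizing M with
  | zero =>
    refine relProjDimLE_iff.2 (mittagLeffler_of_isFree ?_)
    obtain ⟨S, hS⟩ := hM
    exact ⟨S, fun N hN => relProjDimLE_iff.1 (hS.mem_class N hN), hS.directed, hS.iSup_mem,
      hS.exists_ge⟩
  | succ n ih =>
    exact relProjDimLE_iff.2 ⟨M × Bool →₀ R, _, _, freeCover R M, inferInstance,
      freeCover_surjective, relProjDimLE_iff.1 (ih (isFree_coverKernel hY hM))⟩

theorem isFree_of_relProjDimLE {Y : ModuleCat.{u} R → Prop} (hY : IsStable Y) {n : ℕ}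
    {M : ModuleCat.{u} R} (hM : RelProjDimLE Y n M) : IsFree ℵ₁ (RelProjDimLE Y n) M := by
  refine ⟨{⊤}, ?_, directedOn_singleton _, ?_, fun T _ => ⟨⊤, rfl, fun _ _ => trivial⟩⟩
  · rintro _ rfl
    exact relProjDimLE_iff.2 ((relProjDimLE_iff.1 hM).congr hY Submodule.topEquiv.symm)
  · intro μ hμ _ f _ hf
    have : Nonempty (Set.Iio μ) := ⟨⟨0, hμ⟩⟩
    rw [Set.mem_singleton_iff, iSup_congr hf, iSup_const]

end Free

end RelativeML

theorem mainTheorem10 (R : Type u) [Ring R] (X : ModuleCat.{u} Rᵐᵒᵖ → Prop) (n : ℕ)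
    (M : ModuleCat.{u} R) :
    RelativeML.RelProjDimLE (RelativeML.MittagLeffler X) n M ↔
      RelativeML.IsFree ℵ₁ (RelativeML.RelProjDimLE (RelativeML.MittagLeffler X) n) M :=
  ⟨RelativeML.isFree_of_relProjDimLE (RelativeML.isStable_mittagLeffler X),
    RelativeML.relProjDimLE_of_isFree⟩
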